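/- Let $k$ be an algebraically closed field and let $\mathfrak{U}_n$ be the chain $a_n<a_{n-1}<\dots<a_1<b_1<\dots<b_n$ with the involution whose classes are the pairs $z_j=\{a_j,b_j\}$, $1\le j\le n$. A representation $V=(V_0,V_{z_j})_{1\le j\le n}$ of $\mathfrak{U}_n$ consists of a finite-dimensional $k$-vector space $V_0$ and subspaces $V_{z_j}\subseteq V_0^{z_j}$ (functions $z_j\to V_0$, written as pairs $(h(a_j),h(b_j))$) such that, for all $y<x$ in $\mathfrak{U}_n$ and all $h\in V_{[y]}$, the function on the class $[x]$ with value $h(y)$ at $x$ and $0$ elsewhere belongs to $V_{[x]}$. A morphism $V\to W$ is a linear map $\varphi:V_0\to W_0$ with $\varphi\circ h\in W_{z_j}$ for all $j$ and all $h\in V_{z_j}$; direct sums are formed componentwise. A representation is indecomposable if it is nonzero and is not isomorphic to a direct sum of two nonzero representations. Let $S=(k,0)$ be the trivial representation, and for $1\le i\le n$ let * $\mathcal{L}_{1,i}$ have the space $k e$ and the subspaces $0$ for $j<i$, $\langle(0,e)\rangle$ for $j\ge i$; * $\mathcal{L}_{2,i}$ have the space $k e$ and the subspaces $\langle(0,e),(e,0)\rangle$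 for $j\le i$, $\langle(0,e)\rangle$ for $j>i$; * $\mathcal{L}_{3,i}$ have the space $k e_1\oplus k e_2$ and the subspaces $\langle(0,e_1),(e_1,0)\rangle$ for $j<i$, $\langle(0,e_1),(e_1,e_2)\rangle$ for $j=i$, $\langle(0,e_1),(0,e_2)\rangle$ for $j>i$. Then every representation of $\mathfrak{U}_n$ is isomorphic to a finite direct sum of copies of $S$ and of the representations $\mathcal{L}_{1,i},\mathcal{L}_{2,i},\mathcal{L}_{3,i}$. The representation $S$ is indecomposable, and the $\mathcal{L}_{s,i}$ ($1\le s\le 3$, $1\le i\le n$) form a complete list of the nontrivial indecomposable representations: a representation is indecomposable and not isomorphic to $S$ if and only if it is isomorphic to some $\mathcal{L}_{s,i}$, and distinct $\mathcal{L}_{s,i}$ are not isomorphic. -/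

import Mathlib

universe u v w

/-- A partially ordered set with an involution: a poset `P` with an equivalence relation
all of whose classes have at most two elements. -/
structure PosetInvolution (P : Type w) [PartialOrder P] where
  rel : Setoid P
  encard_class_le_two : ∀ x : P, {y : P | rel y x}.encard ≤ 2

namespace PosetInvolution

variable {P : Type w} [PartialOrder P] (θ : PosetInvolution P)

/-- The set of equivalence classes. -/
abbrev Class : Type w := Quotient θ.rel

/-- The equivalence class of an element. -/
abbrev cls (x : P) : θ.Class := Quotient.mk θ.rel x

/-- An equivalence class, seen as the type of its elements. -/
abbrev Fiber (z : θ.Class) : Type w := {x : P // θ.cls x = z}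

/-- An element of the poset, seen as an element of its own class. -/
abbrev self (x : P) : θ.Fiber (θ.cls x) := ⟨x, rfl⟩

end PosetInvolution

open Classical in
/-- The inclusion `i_x : V₀ → V₀^z` for `x ∈ z`: the function `i_x v` has the value `v` at `x`
and vanishes at the other elements of `z`. -/
noncomputable def PosetInvolution.incl {P : Type w} [PartialOrder P] (θ : PosetInvolution P)
    (k : Type u) [Field k] (M : Type v) [AddCommGroup M] [Module k M] (x : P) :
    M →ₗ[k] (θ.Fiber (θ.cls x) → M) where
  toFun p y := if y = θ.self x then p else 0
  map_add' p q := by funext y; by_cases h : y = θ.self x <;> simp [h]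
  map_smul' c p := by funext y; by_cases h : y = θ.self x <;> simp [h]

theorem PosetInvolution.incl_self {P : Type w} [PartialOrder P] (θ : PosetInvolution P)
    (k : Type u) [Field k] (M : Type v) [AddCommGroup M] [Module k M] (x : P) (p : M) :
    θ.incl k M x p (θ.self x) = p := if_pos rfl

theorem PosetInvolution.incl_of_ne {P : Type w} [PartialOrder P] (θ : PosetInvolution P)
    (k : Type u) [Field k] (M : Type v) [AddCommGroup M] [Module k M] (x : P) (p : M)
    (y : θ.Fiber (θ.cls x)) (h : y ≠ θ.self x) : θ.incl k M x p y = 0 := if_neg h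

theorem PosetInvolution.compLeft_incl {P : Type w} [PartialOrder P] (θ : PosetInvolution P)
    {k : Type u} [Field k] {M M' : Type*} [AddCommGroup M] [Module k M] [AddCommGroup M']
    [Module k M'] (f : M →ₗ[k] M') (x : P) (p : M) :
    f.compLeft (θ.Fiber (θ.cls x)) (θ.incl k M x p) = θ.incl k M' x (f p) := by
  funext y
  by_cases h : y = θ.self x
  · subst h
    simp [PosetInvolution.incl_self]
  · simp [PosetInvolution.incl_of_ne, h]

/-- The projection `π_x : V₀^z → V₀`, `h ↦ h x`, for `x ∈ z`. -/
def PosetInvolution.pr {P : Type w} [PartialOrder P] (θ : PosetInvolution P)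
    (k : Type u) [Field k] (M : Type v) [AddCommGroup M] [Module k M] (x : P) :
    (θ.Fiber (θ.cls x) → M) →ₗ[k] M :=
  LinearMap.proj (θ.self x)

/-- A representation `(V₀, V_z)` of a poset with an involution over the field `k`:
a finite-dimensional space `V₀` and subspaces `V_z` of `V₀^z` such that `V_y⁺ ⊆ V_x⁻` for
`y < x`, where `V_y⁺ = π_y(V_[y])` and `V_x⁻ = i_x⁻¹(V_[x])`. -/
structure PosetRep (k : Type u) [Field k] {P : Type w} [PartialOrder P]
    (θ : PosetInvolution P) where
  V₀ : Type v
  [addCommGroup : AddCommGroup V₀]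
  [module : Module k V₀]
  [finite : Module.Finite k V₀]
  sub : ∀ z : θ.Class, Submodule k (θ.Fiber z → V₀)
  plus_le_minus : ∀ y x : P, y < x →
    (sub (θ.cls y)).map (θ.pr k V₀ y) ≤ (sub (θ.cls x)).comap (θ.incl k V₀ x)

attribute [instance] PosetRep.addCommGroup PosetRep.module PosetRep.finite

namespace PosetRep

/-- A morphism `V → W`: a linear map `φ : V₀ → W₀` with `φ^z(V_z) ⊆ W_z` for all classes `z`,
where `φ^z h = φ ∘ h`. -/
structure Hom {k : Type u} [Field k] {P : Type w} [PartialOrder P] {θ : PosetInvolution P}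
    (V W : PosetRep k θ) where
  toLin : V.V₀ →ₗ[k] W.V₀
  map_le : ∀ z : θ.Class, (V.sub z).map (toLin.compLeft (θ.Fiber z)) ≤ W.sub z

/-- An isomorphism of representations: a morphism with a two-sided inverse morphism. -/
structure Iso {k : Type u} [Field k] {P : Type w} [PartialOrder P] {θ : PosetInvolution P}
    (V W : PosetRep k θ) where
  hom : Hom V W
  inv : Hom W V
  inv_comp_hom : inv.toLin ∘ₗ hom.toLin = LinearMap.id
  hom_comp_inv : hom.toLin ∘ₗ inv.toLin = LinearMap.id

/-- The direct sum `V ⊕ W = (V₀ ⊕ W₀, V_z ⊕ W_z)`: a function `h : z → V₀ × W₀` lies in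
`V_z ⊕ W_z` when its two components lie in `V_z` and in `W_z`. -/
def prod {k : Type u} [Field k] {P : Type w} [PartialOrder P] {θ : PosetInvolution P}
    (V W : PosetRep k θ) : PosetRep k θ where
  V₀ := V.V₀ × W.V₀
  sub z := (V.sub z).comap ((LinearMap.fst k V.V₀ W.V₀).compLeft (θ.Fiber z)) ⊓
    (W.sub z).comap ((LinearMap.snd k V.V₀ W.V₀).compLeft (θ.Fiber z))
  plus_le_minus y x hyx := by
    rintro _ ⟨h, ⟨h₁, h₂⟩, rfl⟩
    have e₁ := V.plus_le_minus y x hyx ⟨_, h₁, rfl⟩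
    have e₂ := W.plus_le_minus y x hyx ⟨_, h₂, rfl⟩
    rw [Submodule.mem_comap] at e₁ e₂
    refine ⟨?_, ?_⟩
    · rw [SetLike.mem_coe, Submodule.mem_comap, PosetInvolution.compLeft_incl]
      exact e₁
    · rw [SetLike.mem_coe, Submodule.mem_comap, PosetInvolution.compLeft_incl]
      exact e₂

/-- The direct sum of a finite family of representations. -/
def directSum {k : Type u} [Field k] {P : Type w} [PartialOrder P] {θ : PosetInvolution P}
    {m : ℕ} (V : Fin m → PosetRep k θ) : PosetRep k θ where
  V₀ := ∀ t, (V t).V₀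
  sub z := ⨅ t, ((V t).sub z).comap
    ((LinearMap.proj t : (∀ t, (V t).V₀) →ₗ[k] (V t).V₀).compLeft (θ.Fiber z))
  plus_le_minus y x hyx := by
    rintro _ ⟨h, hh, rfl⟩
    simp only [SetLike.mem_coe, Submodule.mem_iInf] at hh
    simp only [Submodule.mem_comap, Submodule.mem_iInf]
    intro t
    have e := (V t).plus_le_minus y x hyx ⟨_, hh t, rfl⟩
    rw [Submodule.mem_comap] at e
    rw [PosetInvolution.compLeft_incl]
    exact e

/-- A representation is indecomposable when it is nonzero and is not isomorphic to a direct sum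
of two nonzero representations. (A representation is zero exactly when `V₀ = 0`.) -/
def Indecomposable {k : Type u} [Field k] {P : Type w} [PartialOrder P] {θ : PosetInvolution P}
    (V : PosetRep.{u, v, w} k θ) : Prop :=
  Nontrivial V.V₀ ∧ ∀ W W' : PosetRep.{u, v, w} k θ,
    Nonempty (Iso V (prod W W')) → Subsingleton W.V₀ ∨ Subsingleton W'.V₀

end PosetRep

namespace UPoset

/-- The underlying chain `a_n < ⋯ < a_1 < b_1 < ⋯ < b_n` of `𝔘_n`: the reversed chain of the
`a`'s, followed by the chain of the `b`'s. The index set `{1, …, n}` is `Fin n`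
(so `i : Fin n` stands for the index `i + 1`). -/
abbrev Carrier (n : ℕ) : Type := Lex ((Fin n)ᵒᵈ ⊕ Fin n)

/-- The element `a_i`. -/
def a {n : ℕ} (i : Fin n) : Carrier n := toLex (Sum.inl (OrderDual.toDual i))

/-- The element `b_i`. -/
def b {n : ℕ} (i : Fin n) : Carrier n := toLex (Sum.inr i)

/-- The index of an element: both `a_i` and `b_i` have the index `i`. -/
def idx {n : ℕ} (x : Carrier n) : Fin n :=
  Sum.elim (fun i => OrderDual.ofDual i) (fun i => i) (ofLex x)

end UPoset

/-- The poset with involution `𝔘_n`, with the equivalence classes `{a_i, b_i}`. -/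
def UPoset (n : ℕ) : PosetInvolution (UPoset.Carrier n) where
  rel := Setoid.ker UPoset.idx
  encard_class_le_two x := by
    refine (Set.encard_le_encard (t := {UPoset.a (UPoset.idx x), UPoset.b (UPoset.idx x)})
      ?_).trans ((Set.encard_insert_le _ _).trans (by rw [Set.encard_singleton]; rfl))
    rintro (y | y) hy
    · left
      have : y = UPoset.idx x := hy
      rw [← this]; rfl
    · right
      have : y = UPoset.idx x := hy
      rw [← this]; rfl

namespace UPoset

/-- The index `j` of the class `{a_j, b_j}`. -/
def classIdx {n : ℕ} (z : (UPoset n).Class) : Fin n :=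
  Quotient.lift idx (fun _ _ h => h) z

/-- The element `(p, q)` of `V₀^z` for `z = {a_j, b_j}`: the function `a_j ↦ p`, `b_j ↦ q`. -/
def pair {n : ℕ} {M : Type v} (z : (UPoset n).Class) (p q : M) : (UPoset n).Fiber z → M :=
  fun x => Sum.elim (fun _ => p) (fun _ => q) (ofLex x.1)

theorem incl_a {n : ℕ} {k : Type u} [Field k] {M : Type v} [AddCommGroup M] [Module k M]
    (j : Fin n) (p : M) :
    (UPoset n).incl k M (a j) p = pair ((UPoset n).cls (a j)) p 0 := by
  funext ⟨t, ht⟩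
  have ht' : idx t = j := Quotient.exact ht
  rcases t with t | t
  · have : t = OrderDual.toDual j := ht'
    subst this
    exact PosetInvolution.incl_self _ k M _ p
  · refine PosetInvolution.incl_of_ne _ k M (a j) p _ (fun h => ?_)
    exact Sum.inr_ne_inl (congrArg Subtype.val h)

theorem incl_b {n : ℕ} {k : Type u} [Field k] {M : Type v} [AddCommGroup M] [Module k M]
    (j : Fin n) (p : M) :
    (UPoset n).incl k M (b j) p = pair ((UPoset n).cls (b j)) 0 p := by
  funext ⟨t, ht⟩
  have ht' : idx t = j := Quotient.exact ht
  rcases t with t | t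
  · refine PosetInvolution.incl_of_ne _ k M (b j) p _ (fun h => ?_)
    exact Sum.inl_ne_inr (congrArg Subtype.val h)
  · have : t = j := ht'
    subst this
    exact PosetInvolution.incl_self _ k M (b t) p

/-- The condition on the subspaces of a representation of `𝔘_n`, for a family of subspaces
given by spanning sets. -/
theorem plus_le_minus_of {n : ℕ} {k : Type u} [Field k] {M : Type v} [AddCommGroup M]
    [Module k M] (s : Fin n → Set (M × M))
    (haa : ∀ i j, i < j → ∀ g ∈ s j, (g.1, (0 : M)) ∈ Submodule.span k (s i))
    (hab : ∀ i j, ∀ g ∈ s j, ((0 : M), g.1) ∈ Submodule.span k (s i))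
    (hbb : ∀ i j, j < i → ∀ g ∈ s j, ((0 : M), g.2) ∈ Submodule.span k (s i))
    (y x : Carrier n) (hyx : y < x) :
    (Submodule.span k ((fun g : M × M => pair ((UPoset n).cls y) g.1 g.2) '' s (idx y))).map
        ((UPoset n).pr k M y) ≤
      (Submodule.span k ((fun g : M × M => pair ((UPoset n).cls x) g.1 g.2) '' s (idx x))).comap
        ((UPoset n).incl k M x) := by
  let L : ∀ z : (UPoset n).Class, M × M →ₗ[k] ((UPoset n).Fiber z → M) := fun z =>
    { toFun := fun g => pair z g.1 g.2
      map_add' := by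
        intro g g'; funext ⟨t, ht⟩; rcases t with t | t <;> rfl
      map_smul' := by
        intro c g; funext ⟨t, ht⟩; rcases t with t | t <;> rfl }
  have key : ∀ (z : (UPoset n).Class) (i : Fin n) (g : M × M), g ∈ Submodule.span k (s i) →
      pair z g.1 g.2 ∈
        Submodule.span k ((fun g : M × M => pair z g.1 g.2) '' s i) := by
    intro z i g hg
    have := Submodule.mem_map_of_mem (f := L z) hg
    rwa [Submodule.map_span] at this
  rw [Submodule.map_span_le]
  rintro _ ⟨g, hg, rfl⟩
  rw [Submodule.mem_comap]
  rcases y with j | j <;> rcases x with i | i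
  · have h := haa i j (Sum.Lex.inl_lt_inl_iff (a := j) (b := i) |>.1 hyx) g hg
    have e := incl_a (k := k) (n := n) i g.1
    exact e ▸ key _ _ _ h
  · have h := hab i j g hg
    have e := incl_b (k := k) (n := n) i g.1
    exact e ▸ key _ _ _ h
  · exact absurd hyx Sum.Lex.not_inr_lt_inl
  · have h := hbb i j (Sum.Lex.inr_lt_inr_iff.1 hyx) g hg
    have e := incl_b (k := k) (n := n) i g.2
    exact e ▸ key _ _ _ h

/-- The trivial representation `S = (k, 0)`. -/
def S (k : Type u) [Field k] (n : ℕ) : PosetRep.{u, u, 0} k (UPoset n) where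
  V₀ := k
  sub _ := ⊥
  plus_le_minus y x _ := by
    rintro _ ⟨h, hh, rfl⟩
    have : h = 0 := hh
    subst this
    simp

/-- The subspace of `M^z` spanned by the pairs in a set `s`. -/
def spanPairs (k : Type u) [Field k] {n : ℕ} {M : Type v} [AddCommGroup M] [Module k M]
    (z : (UPoset n).Class) (s : Set (M × M)) : Submodule k ((UPoset n).Fiber z → M) :=
  Submodule.span k ((fun g : M × M => pair z g.1 g.2) '' s)

/-- `𝓛_{1,i}`: the space `k e` (`e = 1`), with the subspaces
`0` if `j < i`, and `⟨(0, e)⟩` if `j ≥ i`. -/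
def L₁ (k : Type u) [Field k] (n : ℕ) (i : Fin n) : PosetRep.{u, u, 0} k (UPoset n) where
  V₀ := k
  sub z := spanPairs k z
    (if classIdx z < i then ∅ else {(0, 1)})
  plus_le_minus := by
    refine plus_le_minus_of (k := k) (M := k) (fun j => if j < i then ∅ else {(0, 1)}) ?_ ?_ ?_
    · intro j l hjl g hg
      split_ifs at hg with h₁
      · simp at hg
      · obtain rfl : g = _ := hg
        exact Submodule.zero_mem _
    · intro j l g hg
      split_ifs at hg with h₁
      · simp at hg
      · obtain rfl : g = _ := hg
        exact Submodule.zero_mem _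
    · intro j l hjl g hg
      split_ifs at hg with h₁
      · simp at hg
      · obtain rfl : g = _ := hg
        rw [if_neg (fun h => h₁ (hjl.trans h))]
        exact Submodule.subset_span rfl

/-- `𝓛_{2,i}`: the space `k e` (`e = 1`), with the subspaces
`⟨(0, e), (e, 0)⟩` if `j ≤ i`, and `⟨(0, e)⟩` if `j > i`. -/
def L₂ (k : Type u) [Field k] (n : ℕ) (i : Fin n) : PosetRep.{u, u, 0} k (UPoset n) where
  V₀ := k
  sub z := spanPairs k z
    (if classIdx z ≤ i then {(0, 1), (1, 0)} else {(0, 1)})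
  plus_le_minus := by
    have h01 : ∀ j : Fin n, ((0 : k), (1 : k)) ∈
        Submodule.span k (if j ≤ i then ({(0, 1), (1, 0)} : Set (k × k)) else {(0, 1)}) := by
      intro j
      apply Submodule.subset_span
      split_ifs <;> simp
    refine plus_le_minus_of (k := k) (M := k)
      (fun j => if j ≤ i then {(0, 1), (1, 0)} else {(0, 1)}) ?_ ?_ ?_
    · intro j l hjl g hg
      split_ifs at hg with h₁
      · rw [if_pos (hjl.le.trans h₁)]
        rcases hg with rfl | rfl
        · exact Submodule.zero_mem _
        · exact Submodule.subset_span (by simp)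
      · obtain rfl : g = _ := hg
        exact Submodule.zero_mem _
    · intro j l g hg
      split_ifs at hg with h₁
      · rcases hg with rfl | rfl
        · exact Submodule.zero_mem _
        · exact h01 j
      · obtain rfl : g = _ := hg
        exact Submodule.zero_mem _
    · intro j l hjl g hg
      split_ifs at hg with h₁
      · rcases hg with rfl | rfl
        · exact h01 j
        · exact Submodule.zero_mem _
      · obtain rfl : g = _ := hg
        exact h01 j

/-- `𝓛_{3,i}`: the space `k² = k e₁ ⊕ k e₂`, with the subspaces
`⟨(0, e₁), (e₁, 0)⟩` if `j < i`, `⟨(0, e₁), (e₁, e₂)⟩` if `j = i`, and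
`⟨(0, e₁), (0, e₂)⟩` if `j > i`. -/
def L₃ (k : Type u) [Field k] (n : ℕ) (i : Fin n) : PosetRep.{u, u, 0} k (UPoset n) where
  V₀ := k × k
  sub z := spanPairs k z
    (if classIdx z < i then {(0, (1, 0)), ((1, 0), 0)}
      else if classIdx z = i then {(0, (1, 0)), ((1, 0), (0, 1))}
      else {(0, (1, 0)), (0, (0, 1))})
  plus_le_minus := by
    have h01 : ∀ j : Fin n, ((0 : k × k), ((1 : k), (0 : k))) ∈
        Submodule.span k (if j < i then ({(0, (1, 0)), ((1, 0), 0)} : Set ((k × k) × (k × k)))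
          else if j = i then {(0, (1, 0)), ((1, 0), (0, 1))}
          else {(0, (1, 0)), (0, (0, 1))}) := by
      intro j
      apply Submodule.subset_span
      split_ifs <;> simp
    refine plus_le_minus_of (k := k) (M := k × k)
      (fun j => if j < i then {(0, (1, 0)), ((1, 0), 0)}
        else if j = i then {(0, (1, 0)), ((1, 0), (0, 1))}
        else {(0, (1, 0)), (0, (0, 1))}) ?_ ?_ ?_
    · intro j l hjl g hg
      split_ifs at hg with h₁ h₂
      · rw [if_pos (hjl.trans h₁)]
        rcases hg with rfl | rfl
        · exact Submodule.zero_mem _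
        · exact Submodule.subset_span (by simp)
      · rw [if_pos (h₂ ▸ hjl)]
        rcases hg with rfl | rfl
        · exact Submodule.zero_mem _
        · exact Submodule.subset_span (by simp)
      · rcases hg with rfl | rfl <;> exact Submodule.zero_mem _
    · intro j l g hg
      split_ifs at hg with h₁ h₂
      · rcases hg with rfl | rfl
        · exact Submodule.zero_mem _
        · exact h01 j
      · rcases hg with rfl | rfl
        · exact Submodule.zero_mem _
        · exact h01 j
      · rcases hg with rfl | rfl <;> exact Submodule.zero_mem _
    · intro j l hjl g hg
      split_ifs at hg with h₁ h₂
      · rcases hg with rfl | rfl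
        · exact h01 j
        · exact Submodule.zero_mem _
      · rcases hg with rfl | rfl
        · exact h01 j
        · have h : i < j := h₂ ▸ hjl
          rw [if_neg h.not_gt, if_neg h.ne']
          exact Submodule.subset_span (by simp)
      · rcases hg with rfl | rfl
        · exact h01 j
        · have h : i < j := lt_of_le_of_lt (not_lt.1 h₁) hjl
          rw [if_neg h.not_gt, if_neg h.ne']
          exact Submodule.subset_span (by simp)

/-- The labels of the nontrivial representations in the list: `(1, i)`, `(2, i)`, `(3, i)`
with `1 ≤ i ≤ n`. -/
inductive Label (n : ℕ) : Type
  | one (i : Fin n)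
  | two (i : Fin n)
  | three (i : Fin n)

/-- The representation `𝓛_{s,i}` with the label `(s, i)`. -/
def L (k : Type u) [Field k] (n : ℕ) : Label n → PosetRep.{u, u, 0} k (UPoset n)
  | .one i => L₁ k n i
  | .two i => L₂ k n i
  | .three i => L₃ k n i

end UPoset

namespace PosetRep

section General

variable {k : Type u} [Field k] {P : Type w} [PartialOrder P] {θ : PosetInvolution P}

/-- The composite of two morphisms. -/
def Hom.comp {U : PosetRep k θ} {V : PosetRep k θ} {W : PosetRep k θ} (g : Hom V W)
    (f : Hom U V) : Hom U W where
  toLin := g.toLin ∘ₗ f.toLin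
  map_le z := by
    rintro _ ⟨h, hh, rfl⟩
    exact g.map_le z ⟨_, f.map_le z ⟨h, hh, rfl⟩, rfl⟩

/-- The inverse isomorphism. -/
def Iso.symm {V : PosetRep k θ} {W : PosetRep k θ} (e : Iso V W) : Iso W V where
  hom := e.inv
  inv := e.hom
  inv_comp_hom := e.hom_comp_inv
  hom_comp_inv := e.inv_comp_hom

/-- The composite of two isomorphisms. -/
def Iso.trans {U : PosetRep k θ} {V : PosetRep k θ} {W : PosetRep k θ} (e : Iso U V)
    (f : Iso V W) : Iso U W where
  hom := f.hom.comp e.hom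
  inv := e.inv.comp f.inv
  inv_comp_hom := by
    ext x
    have h₁ := LinearMap.congr_fun f.inv_comp_hom (e.hom.toLin x)
    have h₂ := LinearMap.congr_fun e.inv_comp_hom x
    simp only [LinearMap.comp_apply, LinearMap.id_apply] at h₁ h₂
    simp [Hom.comp, h₁, h₂]
  hom_comp_inv := by
    ext x
    have h₁ := LinearMap.congr_fun e.hom_comp_inv (f.inv.toLin x)
    have h₂ := LinearMap.congr_fun f.hom_comp_inv x
    simp only [LinearMap.comp_apply, LinearMap.id_apply] at h₁ h₂
    simp [Hom.comp, h₁, h₂]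

/-- The linear equivalence underlying an isomorphism. -/
def Iso.toLinearEquiv {V : PosetRep k θ} {W : PosetRep k θ} (e : Iso V W) : V.V₀ ≃ₗ[k] W.V₀ :=
  LinearEquiv.ofLinearMap e.hom.toLin e.inv.toLin e.hom_comp_inv e.inv_comp_hom

/-- A subspace `U` of `V₀` with the induced subspaces `V_z ∩ U^z`. -/
def restrict (V : PosetRep.{u, v, w} k θ) (U : Submodule k V.V₀) : PosetRep.{u, v, w} k θ where
  V₀ := U
  sub z := (V.sub z).comap (U.subtype.compLeft (θ.Fiber z))
  plus_le_minus y x hyx := by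
    rintro _ ⟨h, hh, rfl⟩
    have e := V.plus_le_minus y x hyx ⟨_, hh, rfl⟩
    rw [Submodule.mem_comap] at e
    rw [Submodule.mem_comap, Submodule.mem_comap, PosetInvolution.compLeft_incl]
    exact e

/-- The inclusion of a restricted representation. -/
def restrictHom (V : PosetRep.{u, v, w} k θ) (U : Submodule k V.V₀) : Hom (V.restrict U) V where
  toLin := U.subtype
  map_le z := by
    rintro _ ⟨h, hh, rfl⟩
    exact hh

/-- A morphism with values in `U` factors through the restriction to `U`. -/
def restrictLift {W : PosetRep k θ} {V : PosetRep k θ} (U : Submodule k V.V₀) (f : Hom W V)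
    (hf : ∀ x, f.toLin x ∈ U) : Hom W (V.restrict U) where
  toLin := f.toLin.codRestrict U hf
  map_le z := by
    rintro _ ⟨h, hh, rfl⟩
    exact f.map_le z ⟨h, hh, rfl⟩

/-- The difference `1 - f` for an endomorphism `f`. -/
def Hom.oneSub {V : PosetRep k θ} (f : Hom V V) : Hom V V where
  toLin := LinearMap.id - f.toLin
  map_le z := by
    rintro _ ⟨h, hh, rfl⟩
    exact (V.sub z).sub_mem hh (f.map_le z ⟨h, hh, rfl⟩)

/-- An idempotent endomorphism splits a representation. -/
theorem nonempty_iso_prod_of_idempotent (V : PosetRep.{u, v, w} k θ) (f : Hom V V)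
    (hf : ∀ x, f.toLin (f.toLin x) = f.toLin x) :
    Nonempty (Iso V (prod (V.restrict (LinearMap.ker f.oneSub.toLin))
      (V.restrict (LinearMap.ker f.toLin)))) := by
  have h₁ : ∀ x, f.toLin x ∈ LinearMap.ker f.oneSub.toLin := fun x => by
    simp [Hom.oneSub, hf]
  have h₂ : ∀ x, f.oneSub.toLin x ∈ LinearMap.ker f.toLin := fun x => by
    simp [Hom.oneSub, hf]
  refine ⟨⟨⟨(restrictLift _ f h₁).toLin.prod (restrictLift _ f.oneSub h₂).toLin, ?_⟩,
    ⟨(restrictHom V (LinearMap.ker f.oneSub.toLin)).toLin.coprod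
      (restrictHom V (LinearMap.ker f.toLin)).toLin, ?_⟩, ?_, ?_⟩⟩
  · rintro z _ ⟨h, hh, rfl⟩
    exact ⟨f.map_le z ⟨h, hh, rfl⟩, f.oneSub.map_le z ⟨h, hh, rfl⟩⟩
  · rintro z _ ⟨h, hh, rfl⟩
    exact (V.sub z).add_mem hh.1 hh.2
  · ext x
    change f.toLin x + (x - f.toLin x) = x
    abel
  · refine LinearMap.ext fun x => ?_
    obtain ⟨⟨x, hx⟩, ⟨y, hy⟩⟩ := x
    have hx' : x - f.toLin x = 0 := hx
    have hy' : f.toLin y = 0 := hy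
    have hx'' : f.toLin x = x := (sub_eq_zero.1 hx').symm
    refine Prod.ext (Subtype.ext ?_) (Subtype.ext ?_)
    · change f.toLin (x + y) = x
      rw [map_add, hy', hx'', add_zero]
    · change x + y - f.toLin (x + y) = y
      rw [map_add, hy', hx'', add_zero, add_sub_cancel_left]

/-- A representation isomorphic to a nonzero one whose only idempotent endomorphisms are
`0` and `1` is indecomposable. -/
theorem indecomposable_of_iso {V : PosetRep.{u, v, w} k θ} {L : PosetRep k θ} (e : Iso V L)
    [Nontrivial L.V₀]
    (hL : ∀ f : Hom L L, (∀ x, f.toLin (f.toLin x) = f.toLin x) →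
      (∀ x, f.toLin x = 0) ∨ ∀ x, f.toLin x = x) :
    V.Indecomposable := by
  refine ⟨e.toLinearEquiv.toEquiv.nontrivial, fun W W' ⟨i⟩ => ?_⟩
  let p : Hom (prod W W') (prod W W') :=
    { toLin := LinearMap.inl k W.V₀ W'.V₀ ∘ₗ LinearMap.fst k W.V₀ W'.V₀
      map_le := by
        rintro z _ ⟨h, hh, rfl⟩
        exact ⟨hh.1, (W'.sub z).zero_mem⟩ }
  let g := i.symm.trans e
  have hg : ∀ x, g.inv.toLin (g.hom.toLin x) = x := LinearMap.congr_fun g.inv_comp_hom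
  have hp : ∀ x, p.toLin x = (x.1, 0) := fun x => rfl
  have key := hL ((g.hom.comp p).comp g.inv) fun x => by
    change g.hom.toLin (p.toLin (g.inv.toLin (g.hom.toLin (p.toLin (g.inv.toLin x))))) =
      g.hom.toLin (p.toLin (g.inv.toLin x))
    rw [hg]
    rfl
  have key' : (∀ x, p.toLin x = 0) ∨ ∀ x, p.toLin x = x := by
    refine key.imp (fun H x => ?_) (fun H x => ?_)
    · have := congrArg g.inv.toLin (H (g.hom.toLin x))
      change g.inv.toLin (g.hom.toLin (p.toLin (g.inv.toLin (g.hom.toLin x)))) = _ at this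
      rwa [hg, hg, map_zero] at this
    · have := congrArg g.inv.toLin (H (g.hom.toLin x))
      change g.inv.toLin (g.hom.toLin (p.toLin (g.inv.toLin (g.hom.toLin x)))) = _ at this
      rwa [hg, hg] at this
  refine key'.imp (fun H => ?_) (fun H => ?_)
  · refine subsingleton_of_forall_eq 0 fun x => ?_
    exact congrArg Prod.fst (H (x, 0))
  · refine subsingleton_of_forall_eq 0 fun x => ?_
    exact (congrArg Prod.snd (H (0, x))).symm

/-- `L` is a retract of `V`. -/
structure Retract (V : PosetRep k θ) (L : PosetRep k θ) where
  r : Hom V L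
  s : Hom L V
  r_s : ∀ x, r.toLin (s.toLin x) = x

/-- A nonzero retract of an indecomposable representation is isomorphic to it. -/
theorem Indecomposable.nonempty_iso_of_retract {V : PosetRep.{u, v, w} k θ}
    (hV : V.Indecomposable) {L : PosetRep k θ} [Nontrivial L.V₀] (ρ : Retract V L) :
    Nonempty (Iso V L) := by
  have hs : Function.Injective ρ.s.toLin := Function.LeftInverse.injective ρ.r_s
  rcases hV.2 _ _ (nonempty_iso_prod_of_idempotent V (ρ.s.comp ρ.r) fun x => by
    change ρ.s.toLin (ρ.r.toLin (ρ.s.toLin (ρ.r.toLin x))) = ρ.s.toLin (ρ.r.toLin x)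
    rw [ρ.r_s]) with h | h
  · exfalso
    obtain ⟨x, hx⟩ := exists_ne (0 : L.V₀)
    have hx' : ρ.s.toLin x ∈ LinearMap.ker (ρ.s.comp ρ.r).oneSub.toLin := by
      change ρ.s.toLin x - ρ.s.toLin (ρ.r.toLin (ρ.s.toLin x)) = 0
      rw [ρ.r_s, sub_self]
    have := congrArg Subtype.val (h.elim ⟨_, hx'⟩ 0)
    exact hx (hs (this.trans (map_zero ρ.s.toLin).symm))
  · have H : ∀ x, ρ.s.toLin (ρ.r.toLin x) = x := fun x => by
      have hx : x - ρ.s.toLin (ρ.r.toLin x) ∈ LinearMap.ker (ρ.s.comp ρ.r).toLin := by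
        change ρ.s.toLin (ρ.r.toLin (x - ρ.s.toLin (ρ.r.toLin x))) = 0
        rw [map_sub, ρ.r_s, sub_self, map_zero]
      have := congrArg Subtype.val (h.elim ⟨_, hx⟩ 0)
      exact (sub_eq_zero.1 this).symm
    exact ⟨⟨ρ.r, ρ.s, LinearMap.ext H, LinearMap.ext ρ.r_s⟩⟩

/-- A family of morphisms `V → W t → V` exhibiting `V` as the direct sum of the `W t`. -/
structure Decomposition {m : ℕ} (V : PosetRep k θ) (W : Fin m → PosetRep k θ) where
  r : ∀ t, Hom V (W t)
  s : ∀ t, Hom (W t) V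
  r_s_self : ∀ t x, (r t).toLin ((s t).toLin x) = x
  r_s_ne : ∀ t t' x, t ≠ t' → (r t).toLin ((s t').toLin x) = 0
  sum_s_r : ∀ x, ∑ t, (s t).toLin ((r t).toLin x) = x

theorem mem_directSum_sub {m : ℕ} {W : Fin m → PosetRep k θ} {z : θ.Class}
    {h : θ.Fiber z → (directSum W).V₀} :
    h ∈ (directSum W).sub z ↔ ∀ t, (fun y => h y t) ∈ (W t).sub z :=
  Submodule.mem_iInf (M := θ.Fiber z → ∀ t, (W t).V₀) _

/-- A decomposition gives an isomorphism to the direct sum. -/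
def Decomposition.iso {m : ℕ} {V : PosetRep k θ} {W : Fin m → PosetRep k θ}
    (d : Decomposition V W) : Iso V (directSum W) :=
  let σ : (∀ t, (W t).V₀) →ₗ[k] V.V₀ := ∑ t, (d.s t).toLin ∘ₗ LinearMap.proj t
  have hσ : ∀ x, σ x = ∑ t, (d.s t).toLin (x t) := fun x => by simp [σ, LinearMap.sum_apply]
  { hom :=
      { toLin := LinearMap.pi fun t => (d.r t).toLin
        map_le := by
          rintro z _ ⟨h, hh, rfl⟩
          exact mem_directSum_sub.2 fun t => (d.r t).map_le z ⟨h, hh, rfl⟩ }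
    inv :=
      { toLin := σ
        map_le := by
          rintro z _ ⟨h, hh, rfl⟩
          have : σ.compLeft (θ.Fiber z) h =
              ∑ t, (d.s t).toLin.compLeft (θ.Fiber z) fun y => h y t := by
            funext y
            rw [Finset.sum_apply]
            exact hσ (h y)
          refine (congrArg (· ∈ V.sub z) this).mpr ?_
          exact (V.sub z).sum_mem fun t _ =>
            (d.s t).map_le z ⟨_, mem_directSum_sub.1 hh t, rfl⟩ }
    inv_comp_hom := LinearMap.ext fun x => (hσ _).trans (d.sum_s_r x)
    hom_comp_inv := LinearMap.ext fun x => funext fun t => by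
      refine (congrArg (d.r t).toLin (hσ x)).trans ?_
      rw [map_sum]
      refine (Finset.sum_eq_single t ?_ ?_).trans (d.r_s_self t _)
      · exact fun t' _ ht => d.r_s_ne t t' _ ht.symm
      · simp }

/-- A retract of `V` together with a decomposition of its kernel decomposes `V`. -/
def Decomposition.cons {m : ℕ} {V : PosetRep k θ} {L : PosetRep k θ}
    {W : Fin m → PosetRep k θ} (ρ : Retract V L)
    (d : Decomposition (V.restrict (LinearMap.ker ρ.r.toLin)) W) :
    Decomposition V (Fin.cons L W : Fin (m + 1) → PosetRep k θ) :=
  have hq : ∀ x, (ρ.s.comp ρ.r).oneSub.toLin x ∈ LinearMap.ker ρ.r.toLin := fun x => by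
    change ρ.r.toLin (x - ρ.s.toLin (ρ.r.toLin x)) = 0
    rw [map_sub, ρ.r_s, sub_self]
  have hq0 : ∀ x, (restrictLift (LinearMap.ker ρ.r.toLin) (ρ.s.comp ρ.r).oneSub hq).toLin
      (ρ.s.toLin x) = 0 := fun x => Subtype.ext (by
    change ρ.s.toLin x - ρ.s.toLin (ρ.r.toLin (ρ.s.toLin x)) = 0
    rw [ρ.r_s, sub_self])
  have hq1 : ∀ x : LinearMap.ker ρ.r.toLin,
      (restrictLift (LinearMap.ker ρ.r.toLin) (ρ.s.comp ρ.r).oneSub hq).toLin x.1 = x :=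
    fun x => Subtype.ext (by
      change x.1 - ρ.s.toLin (ρ.r.toLin x.1) = x.1
      rw [LinearMap.mem_ker.1 x.2, map_zero, sub_zero])
  { r := Fin.cases ρ.r fun t => (d.r t).comp (restrictLift _ (ρ.s.comp ρ.r).oneSub hq)
    s := Fin.cases ρ.s fun t => (restrictHom V _).comp (d.s t)
    r_s_self := Fin.cases ρ.r_s fun t x =>
      (congrArg (d.r t).toLin (hq1 ((d.s t).toLin x))).trans (d.r_s_self t x)
    r_s_ne := by
      refine Fin.cases (Fin.cases (fun _ h => absurd rfl h) fun t' x _ => ?_)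
        fun t => Fin.cases (fun x _ => ?_) fun t' x h => ?_
      · exact ((d.s t').toLin x).2
      · exact (congrArg (d.r t).toLin (hq0 x)).trans (map_zero _)
      · exact (congrArg (d.r t).toLin (hq1 ((d.s t').toLin x))).trans
          (d.r_s_ne t t' x fun e => h (congrArg Fin.succ e))
    sum_s_r := fun x => by
      rw [Fin.sum_univ_succ]
      have := congrArg (restrictHom V (LinearMap.ker ρ.r.toLin)).toLin
        (d.sum_s_r ((restrictLift _ (ρ.s.comp ρ.r).oneSub hq).toLin x))
      rw [map_sum] at this
      refine (congrArg (ρ.s.toLin (ρ.r.toLin x) + ·) this).trans ?_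
      change ρ.s.toLin (ρ.r.toLin x) + (x - ρ.s.toLin (ρ.r.toLin x)) = x
      abel }

/-- If every nonzero representation has a nonzero retract in a class `C`, then every
representation decomposes into members of `C`. -/
theorem exists_decomposition (C : PosetRep k θ → Prop)
    (hC : ∀ V : PosetRep.{u, v, w} k θ, Nontrivial V.V₀ →
      ∃ L, C L ∧ Nontrivial L.V₀ ∧ Nonempty (Retract V L)) (V : PosetRep.{u, v, w} k θ) :
    ∃ (m : ℕ) (W : Fin m → PosetRep k θ), (∀ t, C (W t)) ∧ Nonempty (Decomposition V W) := by
  induction hd : Module.finrank k V.V₀ using Nat.strong_induction_on generalizing V with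
  | _ d ih =>
    rcases subsingleton_or_nontrivial V.V₀ with hV | hV
    · exact ⟨0, Fin.elim0, fun t => t.elim0, ⟨⟨fun t => t.elim0, fun t => t.elim0,
        fun t => t.elim0, fun t => t.elim0, fun x => Subsingleton.elim _ _⟩⟩⟩
    · obtain ⟨L, hL, hL', ⟨ρ⟩⟩ := hC V hV
      have hlt : Module.finrank k (V.restrict (LinearMap.ker ρ.r.toLin)).V₀ < d := by
        rw [← hd]
        refine Submodule.finrank_lt fun h => ?_
        obtain ⟨x, hx⟩ := exists_ne (0 : L.V₀)
        refine hx ?_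
        rw [← ρ.r_s x]
        exact LinearMap.mem_ker.1 (h ▸ Submodule.mem_top)
      obtain ⟨m, W, hW, ⟨e⟩⟩ := ih _ hlt _ rfl
      exact ⟨m + 1, Fin.cons L W, Fin.cases hL hW, ⟨Decomposition.cons ρ e⟩⟩

end General

end PosetRep

namespace UPoset

open PosetRep

variable {k : Type u} [Field k] {n : ℕ}

theorem exists_cls_eq (z : (UPoset n).Class) : ∃ j : Fin n, z = (UPoset n).cls (a j) := by
  induction z using Quotient.inductionOn with
  | _ x => exact ⟨idx x, Quotient.sound rfl⟩

theorem cls_b (j : Fin n) : (UPoset n).cls (b j) = (UPoset n).cls (a j) := Quotient.sound rfl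

/-- The linear map `(p, q) ↦ pair z p q`. -/
def pairLin (k : Type u) [Field k] {M : Type v} [AddCommGroup M] [Module k M]
    (z : (UPoset n).Class) : M × M →ₗ[k] ((UPoset n).Fiber z → M) where
  toFun g := pair z g.1 g.2
  map_add' g g' := by funext ⟨t, ht⟩; rcases t with t | t <;> rfl
  map_smul' c g := by funext ⟨t, ht⟩; rcases t with t | t <;> rfl

theorem exists_eq_pair {M : Type v} (j : Fin n) (h : (UPoset n).Fiber ((UPoset n).cls (a j)) → M) :
    ∃ p q, h = pair _ p q := by
  refine ⟨h ⟨a j, rfl⟩, h ⟨b j, cls_b j⟩, funext fun ⟨t, ht⟩ => ?_⟩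
  have ht' : idx t = j := Quotient.exact ht
  subst ht'
  rcases t with t | t <;> rfl

theorem pair_injective {M : Type v} {j : Fin n} {p q p' q' : M}
    (h : pair ((UPoset n).cls (a j)) p q = pair _ p' q') : p = p' ∧ q = q' :=
  ⟨congrFun h ⟨a j, rfl⟩, congrFun h ⟨b j, cls_b j⟩⟩

/-- The subspace `V_{z_j}`, as a space of pairs. -/
def pairs (V : PosetRep k (UPoset n)) (j : Fin n) : Submodule k (V.V₀ × V.V₀) :=
  (V.sub ((UPoset n).cls (a j))).comap (pairLin k _)

/-- A morphism given by its effect on pairs. -/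
def homOfPairs {V : PosetRep k (UPoset n)} {W : PosetRep k (UPoset n)} (f : V.V₀ →ₗ[k] W.V₀)
    (hf : ∀ j p q, (p, q) ∈ pairs V j → (f p, f q) ∈ pairs W j) : Hom V W where
  toLin := f
  map_le z := by
    rintro _ ⟨h, hh, rfl⟩
    obtain ⟨j, rfl⟩ := exists_cls_eq z
    obtain ⟨p, q, rfl⟩ := exists_eq_pair j h
    have := hf j p q hh
    have e : f.compLeft _ (pair ((UPoset n).cls (a j)) p q) = pair _ (f p) (f q) := by
      funext ⟨t, ht⟩; rcases t with t | t <;> rfl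
    rw [e]
    exact this

theorem hom_pairs {V : PosetRep k (UPoset n)} {W : PosetRep k (UPoset n)} (f : Hom V W)
    {j : Fin n} {p q : V.V₀} (h : (p, q) ∈ pairs V j) :
    (f.toLin p, f.toLin q) ∈ pairs W j := by
  have := f.map_le _ ⟨_, h, rfl⟩
  have e : f.toLin.compLeft _ (pair ((UPoset n).cls (a j)) p q) =
      pair _ (f.toLin p) (f.toLin q) := by
    funext ⟨t, ht⟩; rcases t with t | t <;> rfl
  exact (congrArg (· ∈ W.sub _) e).mp this

section Chain

variable {V : PosetRep k (UPoset n)} {i j : Fin n} {p q : V.V₀}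

theorem pairs_aa (hij : i < j) (h : (p, q) ∈ pairs V j) : (p, 0) ∈ pairs V i := by
  have := V.plus_le_minus (a j) (a i) (Sum.Lex.inl_lt_inl_iff.2 hij) ⟨_, h, rfl⟩
  rw [Submodule.mem_comap, incl_a] at this
  exact this

theorem sub_cls_b (h : (UPoset n).incl k V.V₀ (b i) p ∈ V.sub ((UPoset n).cls (b i))) :
    (0, p) ∈ pairs V i := by
  rw [incl_b] at h
  change pair ((UPoset n).cls (a i)) 0 p ∈ V.sub _
  rwa [cls_b] at h

theorem pairs_ab (i : Fin n) (h : (p, q) ∈ pairs V j) : (0, p) ∈ pairs V i :=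
  sub_cls_b (V.plus_le_minus (a j) (b i) (Sum.Lex.inl_lt_inr _ _) ⟨_, h, rfl⟩)

theorem pairs_bb (hij : j < i) (h : (p, q) ∈ pairs V j) : (0, q) ∈ pairs V i := by
  refine sub_cls_b (V.plus_le_minus (b j) (b i) (Sum.Lex.inr_lt_inr_iff.2 hij)
    ⟨pair _ p q, ?_, rfl⟩)
  rw [cls_b]
  exact h

end Chain

theorem pair_mem_spanPairs {M : Type v} [AddCommGroup M] [Module k M] {j : Fin n} {p q : M}
    {s : Set (M × M)} :
    pair ((UPoset n).cls (a j)) p q ∈ spanPairs k ((UPoset n).cls (a j)) s ↔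
      (p, q) ∈ Submodule.span k s := by
  have : spanPairs k ((UPoset n).cls (a j)) s = (Submodule.span k s).map (pairLin k _) := by
    rw [Submodule.map_span]; rfl
  rw [this]
  constructor
  · rintro ⟨⟨p', q'⟩, h, e⟩
    obtain ⟨rfl, rfl⟩ := pair_injective e
    exact h
  · exact fun h => ⟨_, h, rfl⟩

theorem mem_pairs_S {j : Fin n} {p q : k} :
    ((p, q) : (S k n).V₀ × (S k n).V₀) ∈ pairs (S k n) j ↔ p = 0 ∧ q = 0 := by
  constructor
  · intro h
    have h' : pair ((UPoset n).cls (a j)) p q = 0 := h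
    exact ⟨congrFun h' ⟨a j, rfl⟩, congrFun h' ⟨b j, cls_b j⟩⟩
  · rintro ⟨rfl, rfl⟩
    exact Submodule.zero_mem _

theorem mem_pairs_L₁ {i j : Fin n} {p q : k} :
    ((p, q) : (L₁ k n i).V₀ × (L₁ k n i).V₀) ∈ pairs (L₁ k n i) j ↔
      p = 0 ∧ (j < i → q = 0) := by
  refine pair_mem_spanPairs.trans ?_
  change (p, q) ∈ Submodule.span k (if j < i then (∅ : Set (k × k)) else {(0, 1)}) ↔ _
  split_ifs with h
  · simp [h]
  · simp [h, Submodule.mem_span_singleton, eq_comm]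

theorem mem_pairs_L₂ {i j : Fin n} {p q : k} :
    ((p, q) : (L₂ k n i).V₀ × (L₂ k n i).V₀) ∈ pairs (L₂ k n i) j ↔ (i < j → p = 0) := by
  refine pair_mem_spanPairs.trans ?_
  change (p, q) ∈ Submodule.span k (if j ≤ i then ({(0, 1), (1, 0)} : Set (k × k))
    else {(0, 1)}) ↔ _
  split_ifs with h
  · simp [h.not_gt, Submodule.mem_span_pair]
  · simp [not_le.1 h, Submodule.mem_span_singleton, eq_comm]

theorem mem_pairs_L₃ {i j : Fin n} {p q : k × k} :
    ((p, q) : (L₃ k n i).V₀ × (L₃ k n i).V₀) ∈ pairs (L₃ k n i) j ↔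
      p.2 = 0 ∧ (j < i → q.2 = 0) ∧ (j = i → q.2 = p.1) ∧ (i < j → p.1 = 0) := by
  refine pair_mem_spanPairs.trans ?_
  change (p, q) ∈ Submodule.span k (if j < i then ({(0, (1, 0)), ((1, 0), 0)} :
    Set ((k × k) × (k × k))) else if j = i then {(0, (1, 0)), ((1, 0), (0, 1))}
          else {(0, (1, 0)), (0, (0, 1))}) ↔ _
  obtain ⟨p₁, p₂⟩ := p
  obtain ⟨q₁, q₂⟩ := q
  rcases lt_trichotomy j i with h | h | h
  · simp [h, h.not_gt, h.ne, Submodule.mem_span_pair, eq_comm]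
  · subst h
    simp [Submodule.mem_span_pair, eq_comm, and_comm]
  · simp [h, h.not_gt, h.ne', Submodule.mem_span_pair, eq_comm (b := ((p₁, p₂) : k × k)), and_comm]

/-- A linear form and a vector exhibiting a one-dimensional retract. -/
def retractOfDual {V : PosetRep k (UPoset n)} {L : PosetRep k (UPoset n)} (e : k ≃ₗ[k] L.V₀)
    (f : Module.Dual k V.V₀) (v : V.V₀) (hfv : f v = 1)
    (hr : ∀ j p q, (p, q) ∈ pairs V j → (e (f p), e (f q)) ∈ pairs L j)
    (hs : ∀ j p q, (e p, e q) ∈ pairs L j → (p • v, q • v) ∈ pairs V j) : Retract V L where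
  r := homOfPairs (e.toLinearMap ∘ₗ f) hr
  s := homOfPairs (LinearMap.toSpanSingleton k V.V₀ v ∘ₗ e.symm.toLinearMap) fun j p q h => by
    simpa using hs j (e.symm p) (e.symm q) (by simpa using h)
  r_s x := by
    change e (f (e.symm x • v)) = x
    simp [hfv]

theorem pairs_eq_smul {V : PosetRep k (UPoset n)} {j : Fin n} {v : V.V₀} {p q : k}
    (h₁ : p = 0 ∨ (v, 0) ∈ pairs V j) (h₂ : q = 0 ∨ (0, v) ∈ pairs V j) :
    (p • v, q • v) ∈ pairs V j := by
  have e₁ : (p • v, 0) ∈ pairs V j := by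
    rcases h₁ with rfl | h
    · rw [zero_smul]
      exact (pairs V j).zero_mem
    · simpa using (pairs V j).smul_mem p h
  have e₂ : (0, q • v) ∈ pairs V j := by
    rcases h₂ with rfl | h
    · rw [zero_smul]
      exact (pairs V j).zero_mem
    · simpa using (pairs V j).smul_mem q h
  simpa using (pairs V j).add_mem e₁ e₂

theorem nonempty_retract_L₃ {V : PosetRep k (UPoset n)} {j : Fin n} {e₁ e₂ : V.V₀}
    (h : (e₁, e₂) ∈ pairs V j) (h' : (e₁, 0) ∉ pairs V j) : Nonempty (Retract V (L₃ k n j)) := by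
  let B : Submodule k V.V₀ := (pairs V j).comap (LinearMap.inr k V.V₀ V.V₀)
  have hB : ∀ x, x ∈ B ↔ (0, x) ∈ pairs V j := fun x => Iff.rfl
  have he₂ : e₂ ∉ B := fun he => h' (by simpa using (pairs V j).sub_mem h he)
  obtain ⟨g, hg, hgB⟩ := Submodule.exists_dual_map_eq_bot_of_notMem he₂ inferInstance
  have hgB' : ∀ x, (0, x) ∈ pairs V j → g x = 0 := fun x hx => by
    have : g x ∈ B.map g := ⟨x, hx, rfl⟩
    rwa [hgB] at this
  obtain ⟨f₂, hf₂, hf₂B⟩ : ∃ f₂ : Module.Dual k V.V₀, f₂ e₂ = 1 ∧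
      ∀ x, (0, x) ∈ pairs V j → f₂ x = 0 :=
    ⟨(g e₂)⁻¹ • g, by simp [inv_mul_cancel₀ hg], fun x hx => by simp [hgB' x hx]⟩
  let πa : pairs V j →ₗ[k] V.V₀ := LinearMap.fst k V.V₀ V.V₀ ∘ₗ (pairs V j).subtype
  let πb : pairs V j →ₗ[k] V.V₀ := LinearMap.snd k V.V₀ V.V₀ ∘ₗ (pairs V j).subtype
  have hmem : f₂ ∘ₗ πb ∈ LinearMap.range πa.dualMap := by
    rw [LinearMap.range_dualMap_eq_dualAnnihilator_ker, Submodule.mem_dualAnnihilator]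
    rintro ⟨⟨p, q⟩, hpq⟩ hp
    have hp' : p = 0 := hp
    subst hp'
    exact hf₂B q hpq
  obtain ⟨g₁, hg₁⟩ := hmem
  have hg₁' : ∀ p q, (p, q) ∈ pairs V j → g₁ p = f₂ q := fun p q hpq =>
    LinearMap.congr_fun hg₁ ⟨(p, q), hpq⟩
  have hfa : ∀ i p q, (p, q) ∈ pairs V i → f₂ p = 0 := fun i p q hpq => hf₂B p (pairs_ab j hpq)
  let f₁ : Module.Dual k V.V₀ := g₁ - g₁ e₂ • f₂
  have hf₁ : ∀ p q, (p, q) ∈ pairs V j → f₁ p = f₂ q := fun p q hpq => by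
    simp [f₁, hfa j p q hpq, hg₁' p q hpq]
  have hf₁₂ : f₁ e₂ = 0 := by simp [f₁, hf₂]
  have hf₁₁ : f₁ e₁ = 1 := (hf₁ _ _ h).trans hf₂
  have hf₂₁ : f₂ e₁ = 0 := hfa j _ _ h
  refine ⟨⟨homOfPairs (f₁.prod f₂) fun i p q hpq => ?_,
    homOfPairs ((LinearMap.toSpanSingleton k V.V₀ e₁).coprod
      (LinearMap.toSpanSingleton k V.V₀ e₂)) ?_, ?_⟩⟩
  · refine mem_pairs_L₃.2 ⟨hfa i p q hpq, fun hij => hf₂B q (pairs_bb hij hpq), ?_, fun hij => ?_⟩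
    · rintro rfl
      exact (hf₁ p q hpq).symm
    · exact (hf₁ _ _ (pairs_aa hij hpq)).trans (map_zero f₂)
  · rintro i ⟨p₁, p₂⟩ ⟨q₁, q₂⟩ hpq
    obtain ⟨rfl, c₁, c₂, c₃⟩ := mem_pairs_L₃.1 hpq
    dsimp only at c₁ c₂ c₃
    change (p₁ • e₁ + (0 : k) • e₂, q₁ • e₁ + q₂ • e₂) ∈ pairs V i
    rw [zero_smul, add_zero]
    have hq₁ : (0, q₁ • e₁) ∈ pairs V i := by
      simpa using (pairs V i).smul_mem q₁ (pairs_ab i h)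
    suffices (p₁ • e₁, q₂ • e₂) ∈ pairs V i by simpa using (pairs V i).add_mem hq₁ this
    rcases lt_trichotomy i j with hij | rfl | hij
    · rw [c₁ hij, zero_smul]
      simpa using (pairs V i).smul_mem p₁ (pairs_aa hij h)
    · rw [c₂ rfl]
      simpa using (pairs V i).smul_mem p₁ h
    · rw [c₃ hij, zero_smul]
      simpa using (pairs V i).smul_mem q₂ (pairs_bb hij h)
  · rintro ⟨x, y⟩
    change (f₁ (x • e₁ + y • e₂), f₂ (x • e₁ + y • e₂)) = (x, y)
    simp [hf₁₁, hf₁₂, hf₂₁, hf₂]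

/-- Every nonzero representation has `S` or one of the `𝓛_{s,i}` as a retract. -/
theorem exists_retract (V : PosetRep.{u, v, 0} k (UPoset n)) [Nontrivial V.V₀] :
    Nonempty (Retract V (S k n)) ∨ ∃ c, Nonempty (Retract V (L k n c)) := by
  by_cases h₃ : ∃ j p q, (p, q) ∈ pairs V j ∧ (p, 0) ∉ pairs V j
  · obtain ⟨j, p, q, h, h'⟩ := h₃
    exact Or.inr ⟨.three j, nonempty_retract_L₃ h h'⟩
  push Not at h₃
  by_cases h₂ : ∃ j, ∃ p ≠ 0, (p, 0) ∈ pairs V j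
  · obtain ⟨j, ⟨v, hv, hvj⟩, hmax⟩ : ∃ j, (∃ p ≠ 0, (p, 0) ∈ pairs V j) ∧
        ∀ i, j < i → ∀ p, (p, 0) ∈ pairs V i → p = 0 := by
      obtain ⟨j, hj, hmax⟩ := Set.Finite.exists_maximal
        (Set.toFinite {j | ∃ p ≠ 0, (p, 0) ∈ pairs V j}) h₂
      refine ⟨j, hj, fun i hij p hp => ?_⟩
      by_contra hp0
      exact absurd (hmax ⟨p, hp0, hp⟩ hij.le) (not_le.2 hij)
    obtain ⟨f, hf⟩ := Module.Projective.exists_dual_eq_one k hv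
    refine Or.inr ⟨.two j, ⟨retractOfDual (L := L₂ k n j) (LinearEquiv.refl k k) f v hf
      (fun i p q h => mem_pairs_L₂.2 fun hij => ?_) (fun i p q h => ?_)⟩⟩
    · rw [hmax i hij p (h₃ i p q h), map_zero]
      exact map_zero _
    · have h := mem_pairs_L₂.1 h
      refine pairs_eq_smul ?_ (Or.inr (pairs_ab i hvj))
      rcases lt_trichotomy i j with hij | rfl | hij
      · exact Or.inr (pairs_aa hij hvj)
      · exact Or.inr hvj
      · exact Or.inl (h hij)
  push Not at h₂
  have ha : ∀ i p q, (p, q) ∈ pairs V i → p = 0 := fun i p q h => by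
    by_contra hp
    exact h₂ i p hp (h₃ i p q h)
  by_cases h₁ : ∃ j, ∃ q ≠ 0, (0, q) ∈ pairs V j
  · obtain ⟨j, ⟨v, hv, hvj⟩, hmin⟩ : ∃ j, (∃ q ≠ 0, (0, q) ∈ pairs V j) ∧
        ∀ i, i < j → ∀ q, (0, q) ∈ pairs V i → q = 0 := by
      obtain ⟨j, hj, hmin⟩ := Set.Finite.exists_minimal
        (Set.toFinite {j | ∃ q ≠ 0, (0, q) ∈ pairs V j}) h₁
      refine ⟨j, hj, fun i hij q hq => ?_⟩
      by_contra hq0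
      exact absurd (hmin ⟨q, hq0, hq⟩ hij.le) (not_le.2 hij)
    obtain ⟨f, hf⟩ := Module.Projective.exists_dual_eq_one k hv
    refine Or.inr ⟨.one j, ⟨retractOfDual (L := L₁ k n j) (LinearEquiv.refl k k) f v hf
      (fun i p q h => mem_pairs_L₁.2 ?_) (fun i p q h => ?_)⟩⟩
    · obtain rfl := ha i p q h
      refine ⟨?_, fun hij => ?_⟩
      · rw [map_zero]
        exact map_zero _
      · rw [hmin i hij q h, map_zero]
        exact map_zero _
    · obtain ⟨hp, hq⟩ := mem_pairs_L₁.1 h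
      refine pairs_eq_smul (Or.inl hp) ?_
      rcases lt_trichotomy i j with hij | rfl | hij
      · exact Or.inl (hq hij)
      · exact Or.inr hvj
      · exact Or.inr (pairs_bb hij hvj)
  push Not at h₁
  obtain ⟨v, hv⟩ := exists_ne (0 : V.V₀)
  obtain ⟨f, hf⟩ := Module.Projective.exists_dual_eq_one k hv
  refine Or.inl ⟨retractOfDual (L := S k n) (LinearEquiv.refl k k) f v hf
    (fun i p q h => mem_pairs_S.2 ?_) (fun i p q h => ?_)⟩
  · obtain rfl := ha i p q h
    obtain rfl : q = 0 := by
      by_contra hq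
      exact h₁ i q hq h
    rw [map_zero]
    exact ⟨map_zero _, map_zero _⟩
  · obtain ⟨hp, hq⟩ := mem_pairs_S.1 h
    exact pairs_eq_smul (Or.inl hp) (Or.inl hq)

instance : Nontrivial (S k n).V₀ := inferInstanceAs (Nontrivial k)

instance (c : Label n) : Nontrivial (L k n c).V₀ := by
  cases c
  · exact inferInstanceAs (Nontrivial k)
  · exact inferInstanceAs (Nontrivial k)
  · exact inferInstanceAs (Nontrivial (k × k))

theorem linearMap_idempotent (f : k →ₗ[k] k) (hf : ∀ x, f (f x) = f x) :
    (∀ x, f x = 0) ∨ ∀ x, f x = x := by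
  have h : ∀ x, f x = x * f 1 := fun x => by simpa using f.map_smul x 1
  have h1 := hf 1
  rw [h (f 1)] at h1
  rcases eq_or_ne (f 1) 0 with h0 | h0
  · exact Or.inl fun x => by rw [h, h0, mul_zero]
  · exact Or.inr fun x => by rw [h, mul_right_cancel₀ h0 (h1.trans (one_mul _).symm), mul_one]

theorem L₃_idempotent (i : Fin n) (f : Hom (L₃ k n i) (L₃ k n i))
    (hf : ∀ x, f.toLin (f.toLin x) = f.toLin x) :
    (∀ x, f.toLin x = 0) ∨ ∀ x, f.toLin x = x := by
  let φ : k × k →ₗ[k] k × k := f.toLin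
  have hφ : ∀ x, φ (φ x) = φ x := hf
  change (∀ x, φ x = 0) ∨ ∀ x, φ x = x
  have m₁ : ((0, φ (1, 0)) : (k × k) × (k × k)) ∈ pairs (L₃ k n i) i := by
    have := hom_pairs f (j := i) (p := ((0, 0) : k × k)) (q := ((1, 0) : k × k))
      (mem_pairs_L₃.2 (by simp))
    rwa [show f.toLin ((0, 0) : k × k) = 0 from map_zero f.toLin] at this
  have m₂ : ((φ (1, 0), φ (0, 1)) : (k × k) × (k × k)) ∈ pairs (L₃ k n i) i :=
    hom_pairs f (j := i) (p := ((1, 0) : k × k)) (q := ((0, 1) : k × k))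
      (mem_pairs_L₃.2 (by simp))
  have e₁ : (φ (1, 0)).2 = 0 := (mem_pairs_L₃.1 m₁).2.2.1 rfl
  have e₂ : (φ (0, 1)).2 = (φ (1, 0)).1 := (mem_pairs_L₃.1 m₂).2.2.1 rfl
  set α := (φ (1, 0)).1 with hα
  set β := (φ (0, 1)).1 with hβ
  have v₁ : φ (1, 0) = (α, 0) := Prod.ext rfl e₁
  have v₂ : φ (0, 1) = (β, α) := Prod.ext rfl e₂
  have hx : ∀ x y, φ (x, y) = (x * α + y * β, y * α) := fun x y => by
    have : ((x, y) : k × k) = x • (1, 0) + y • (0, 1) := by simp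
    rw [this, map_add, map_smul, map_smul, v₁, v₂]
    simp
  have i₁ := hφ (1, 0)
  have i₂ := hφ (0, 1)
  rw [v₁, hx] at i₁
  rw [v₂, hx] at i₂
  simp only [Prod.mk.injEq] at i₁ i₂
  have hα2 : α * α = α := by simpa using i₁.1
  have hβ2 : β * α + α * β = β := i₂.1
  rcases eq_or_ne α 0 with h0 | h0
  · have hβ0 : β = 0 := by simpa [h0] using hβ2.symm
    exact Or.inl fun ⟨x, y⟩ => by simp [hx, h0, hβ0]
  · have hα1 : α = 1 := mul_right_cancel₀ h0 (hα2.trans (one_mul α).symm)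
    have hβ0 : β = 0 := by simpa [hα1] using hβ2
    exact Or.inr fun ⟨x, y⟩ => by simp [hx, hα1, hβ0]

theorem L_idempotent (c : Label n) (f : Hom (L k n c) (L k n c))
    (hf : ∀ x, f.toLin (f.toLin x) = f.toLin x) :
    (∀ x, f.toLin x = 0) ∨ ∀ x, f.toLin x = x := by
  cases c with
  | one i => exact linearMap_idempotent (k := k) f.toLin hf
  | two i => exact linearMap_idempotent (k := k) f.toLin hf
  | three i => exact L₃_idempotent i f hf

theorem indecomposable_S : (S k n).Indecomposable := by
  refine indecomposable_of_iso (L := S k n) ⟨⟨LinearMap.id, fun z => ?_⟩, ⟨LinearMap.id, fun z => ?_⟩,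
    rfl, rfl⟩ fun f hf => linearMap_idempotent (k := k) f.toLin hf
  all_goals
    rintro _ ⟨h, hh, rfl⟩
    exact hh

/-- `V_{z_j}` contains a function that does not vanish at `a_j`. -/
def APos (V : PosetRep k (UPoset n)) (j : Fin n) : Prop := ∃ p q, (p, q) ∈ pairs V j ∧ p ≠ 0

/-- `V_{z_j}` contains a function that does not vanish at `b_j`. -/
def BPos (V : PosetRep k (UPoset n)) (j : Fin n) : Prop := ∃ p q, (p, q) ∈ pairs V j ∧ q ≠ 0

section Invariants

variable {V : PosetRep k (UPoset n)} {W : PosetRep k (UPoset n)} {i j : Fin n}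

theorem APos.of_iso (e : Iso V W) (h : APos V j) : APos W j := by
  obtain ⟨p, q, h, hp⟩ := h
  exact ⟨_, _, hom_pairs e.hom h, fun h0 => hp (e.toLinearEquiv.map_eq_zero_iff.1 h0)⟩

theorem BPos.of_iso (e : Iso V W) (h : BPos V j) : BPos W j := by
  obtain ⟨p, q, h, hp⟩ := h
  exact ⟨_, _, hom_pairs e.hom h, fun h0 => hp (e.toLinearEquiv.map_eq_zero_iff.1 h0)⟩

theorem not_APos_S : ¬ APos (S k n) j := fun ⟨_, _, h, hp⟩ => hp (mem_pairs_S.1 h).1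

theorem not_BPos_S : ¬ BPos (S k n) j := fun ⟨_, _, h, hp⟩ => hp (mem_pairs_S.1 h).2

theorem not_APos_L₁ : ¬ APos (L₁ k n i) j := fun ⟨_, _, h, hp⟩ => hp (mem_pairs_L₁.1 h).1

theorem BPos_L₁ : BPos (L₁ k n i) j ↔ i ≤ j := by
  constructor
  · rintro ⟨p, q, h, hq⟩
    exact not_lt.1 fun hji => hq ((mem_pairs_L₁.1 h).2 hji)
  · exact fun h => ⟨(0 : k), (1 : k), mem_pairs_L₁.2 ⟨rfl, fun h' => absurd h h'.not_ge⟩,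
      one_ne_zero (α := k)⟩

theorem APos_L₂ : APos (L₂ k n i) j ↔ j ≤ i := by
  constructor
  · rintro ⟨p, q, h, hp⟩
    exact not_lt.1 fun hij => hp ((mem_pairs_L₂ (k := k)).1 h hij)
  · exact fun h => ⟨(1 : k), (0 : k), mem_pairs_L₂.2 fun h' => absurd h h'.not_ge,
      one_ne_zero (α := k)⟩

theorem APos_L₃ : APos (L₃ k n i) j ↔ j ≤ i := by
  constructor
  · rintro ⟨p, q, h, hp⟩
    obtain ⟨h₁, -, -, h₂⟩ := mem_pairs_L₃.1 h
    exact not_lt.1 fun hij => hp (Prod.ext (h₂ hij) h₁)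
  · intro h
    have hne : ((1, 0) : k × k) ≠ 0 := by simp
    rcases h.lt_or_eq with h | rfl
    · exact ⟨((1, 0) : k × k), ((0, 0) : k × k),
        mem_pairs_L₃.2 ⟨rfl, fun _ => rfl, fun e => absurd e h.ne, fun h' => absurd h h'.not_gt⟩,
        hne⟩
    · exact ⟨((1, 0) : k × k), ((0, 1) : k × k),
        mem_pairs_L₃.2 ⟨rfl, fun h => absurd h (lt_irrefl _), fun _ => rfl,
          fun h => absurd h (lt_irrefl _)⟩, hne⟩

end Invariants

theorem not_iso_L_S (c : Label n) (e : Iso (L k n c) (S k n)) : False := by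
  cases c with
  | one i => exact not_BPos_S (BPos.of_iso (j := i) e (BPos_L₁.2 le_rfl))
  | two i => exact not_APos_S (APos.of_iso (j := i) e (APos_L₂.2 le_rfl))
  | three i => exact not_APos_S (APos.of_iso (j := i) e (APos_L₃.2 le_rfl))

theorem not_linearEquiv_prod (e : k ≃ₗ[k] k × k) : False := by
  have := e.finrank_eq
  simp at this

theorem L_injective (c c' : Label n) (e : Iso (L k n c) (L k n c')) : c = c' := by
  cases c with
  | one i =>
    cases c' with
    | one j =>
      exact congrArg _ (le_antisymm (BPos_L₁.1 (BPos.of_iso e.symm (BPos_L₁.2 le_rfl)))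
        (BPos_L₁.1 (BPos.of_iso e (BPos_L₁.2 le_rfl))))
    | two j => exact absurd (APos.of_iso e.symm (APos_L₂.2 (le_refl j))) not_APos_L₁
    | three j => exact absurd (APos.of_iso e.symm (APos_L₃.2 (le_refl j))) not_APos_L₁
  | two i =>
    cases c' with
    | one j => exact absurd (APos.of_iso e (APos_L₂.2 (le_refl i))) not_APos_L₁
    | two j =>
      exact congrArg _ (le_antisymm (APos_L₂.1 (APos.of_iso e (APos_L₂.2 le_rfl)))
        (APos_L₂.1 (APos.of_iso e.symm (APos_L₂.2 le_rfl))))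
    | three j => exact (not_linearEquiv_prod (k := k) e.toLinearEquiv).elim
  | three i =>
    cases c' with
    | one j => exact (not_linearEquiv_prod (k := k) e.symm.toLinearEquiv).elim
    | two j => exact (not_linearEquiv_prod (k := k) e.symm.toLinearEquiv).elim
    | three j =>
      exact congrArg _ (le_antisymm (APos_L₃.1 (APos.of_iso e (APos_L₃.2 le_rfl)))
        (APos_L₃.1 (APos.of_iso e.symm (APos_L₃.2 le_rfl))))

end UPoset

theorem proposition10 (k : Type u) [Field k] [IsAlgClosed k] (n : ℕ) :
    -- every representation is a finite direct sum of copies of `S` and of the `𝓛_{s,i}`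
    (∀ V : PosetRep.{u, v, 0} k (UPoset n),
      ∃ (m : ℕ) (W : Fin m → PosetRep.{u, u, 0} k (UPoset n)),
        (∀ t, W t = UPoset.S k n ∨ ∃ c : UPoset.Label n, W t = UPoset.L k n c) ∧
          Nonempty (PosetRep.Iso V (PosetRep.directSum W))) ∧
    -- the trivial representation is indecomposable
    (UPoset.S k n).Indecomposable ∧
    -- the nontrivial indecomposables are, up to isomorphism, exactly the `𝓛_{s,i}`
    (∀ V : PosetRep.{u, v, 0} k (UPoset n),
      (V.Indecomposable ∧ ¬ Nonempty (PosetRep.Iso V (UPoset.S k n))) ↔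
        ∃ c : UPoset.Label n, Nonempty (PosetRep.Iso V (UPoset.L k n c))) ∧
    -- the list has no repetitions
    (∀ c c' : UPoset.Label n,
      Nonempty (PosetRep.Iso (UPoset.L k n c) (UPoset.L k n c')) → c = c') := by
  have hS : ∀ V : PosetRep.{u, v, 0} k (UPoset n), Nontrivial V.V₀ →
      ∃ L : PosetRep.{u, u, 0} k (UPoset n), (L = UPoset.S k n ∨ ∃ c, L = UPoset.L k n c) ∧
        Nontrivial L.V₀ ∧ Nonempty (PosetRep.Retract V L) := by
    intro V _
    rcases UPoset.exists_retract V with h | ⟨c, h⟩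
    · exact ⟨_, Or.inl rfl, inferInstance, h⟩
    · exact ⟨_, Or.inr ⟨c, rfl⟩, inferInstance, h⟩
  refine ⟨fun V => ?_, UPoset.indecomposable_S, fun V => ⟨fun ⟨hV, hVS⟩ => ?_, fun ⟨c, ⟨e⟩⟩ => ?_⟩,
    fun c c' ⟨e⟩ => UPoset.L_injective c c' e⟩
  · obtain ⟨m, W, hW, ⟨d⟩⟩ := PosetRep.exists_decomposition _ hS V
    exact ⟨m, W, hW, ⟨d.iso⟩⟩
  · have := hV.1
    rcases UPoset.exists_retract V with ⟨⟨ρ⟩⟩ | ⟨c, ⟨ρ⟩⟩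
    · exact absurd (hV.nonempty_iso_of_retract ρ) hVS
    · exact ⟨c, hV.nonempty_iso_of_retract ρ⟩
  · exact ⟨PosetRep.indecomposable_of_iso e (UPoset.L_idempotent c),
      fun ⟨e'⟩ => UPoset.not_iso_L_S c (e.symm.trans e')⟩
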